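/- Place $n$ boundary vertices $V_1,\dots,V_n$ in clockwise order on the boundary circle of a disk, and place $2n$ medial boundary vertices on the circle, so that in clockwise order one meets $A_1,V_1,B_1,A_2,V_2,B_2,\dots,A_n,V_n,B_n$. A wiring diagram of order $n$ (lensless, and considered up to motion-equivalence) joins the $2n$ medial boundary vertices in pairs by $n$ wires, each medial boundary vertex being the endpoint of exactly one wire, and is determined by which pairs are joined; that is, it is a perfect matching of the $2n$ medial boundary vertices. A dividing line of a wiring diagram is a line $V_iV_j$ with $i\neq j$ such that no wire connects two medial boundary vertices on opposite sides of $V_iV_j$. A wiring diagram is full if it has no dividing line. Let $X_n$ be the number of full wiring diagrams of order $n\ge 0$, let $X(t)=\sum_{n\ge 0}X_nt^n$, and write $m!!$ for the double factorial, with $(-1)!!=1$. Then: (a) $X_1=1$, and for all $n\ge 2$, $$X_n=2(n-1)X_{n-1}+\sum_{j=2}^{n-2}(j-1)X_jX_{n-j};$$ (b) $X_0=1$, and for all $n\ge 1$, $[t^{n-1}]\,X(t)^n=n\cdot(2n-3)!!$; (c) $\displaystyle\lim_{n\to\infty}\frac{X_n}{(2n-1)!!}=e^{-1/2}$. -/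

import Mathlib

open Filter Topology
open scoped Nat

/-- A wiring diagram of order `n` (lensless, up to motion-equivalence).

The disk has `n` boundary vertices `V 0, …, V (n-1)` on its boundary circle, in clockwise order.
Around the circle there are `2 * n` medial boundary vertices, numbered clockwise by `Fin (2 * n)`:
the medial boundary vertices next to `V k` are `2 * k` and `2 * k + 1`, so that the clockwise order
around the circle is `0, V 0, 1, 2, V 1, 3, 4, V 2, 5, …, 2n-2, V (n-1), 2n-1`.

A motion-equivalence class of lensless wiring diagrams is the datum of which pairs of medial
boundary vertices are joined by the `n` wires, every medial boundary vertex being the endpoint of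
exactly one wire; it is recorded by the map sending an endpoint of a wire to the other one. -/
@[ext]
structure WiringDiagram (n : ℕ) where
  /-- The other endpoint of the wire that ends at a given medial boundary vertex. -/
  partner : Fin (2 * n) → Fin (2 * n)
  partner_partner : ∀ p, partner (partner p) = p
  partner_ne : ∀ p, partner p ≠ p

namespace WiringDiagram

/-- The line `V i V j` splits the medial boundary vertices into two sides. This is the side that
consists of those met when travelling clockwise from `V (min i j)` to `V (max i j)`, namely
`2 * min i j + 1, …, 2 * max i j`; the other side is its complement. -/
def InnerSide {n : ℕ} (i j : Fin n) (p : Fin (2 * n)) : Prop :=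
  2 * (min i j : Fin n).val + 1 ≤ p.val ∧ p.val ≤ 2 * (max i j : Fin n).val

/-- `p` and `q` lie on opposite sides of the line `V i V j`. -/
def OppositeSides {n : ℕ} (i j : Fin n) (p q : Fin (2 * n)) : Prop :=
  ¬ (InnerSide i j p ↔ InnerSide i j q)

/-- `V i V j` is a dividing line of `W`: `i ≠ j`, and no wire of `W` connects two points on
opposite sides of it. -/
def IsDividingLine {n : ℕ} (W : WiringDiagram n) (i j : Fin n) : Prop :=
  i ≠ j ∧ ¬ ∃ p : Fin (2 * n), OppositeSides i j p (W.partner p)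

/-- A wiring diagram is full if it has no dividing lines. -/
def IsFull {n : ℕ} (W : WiringDiagram n) : Prop :=
  ¬ ∃ i j : Fin n, W.IsDividingLine i j

instance (n : ℕ) : Finite (WiringDiagram n) :=
  Finite.of_injective WiringDiagram.partner fun _ _ h => WiringDiagram.ext h

end WiringDiagram

/-- `numFull n` is the number `X_n` of full wiring diagrams of order `n`. -/
noncomputable def numFull (n : ℕ) : ℕ :=
  Nat.card {W : WiringDiagram n // W.IsFull}

/-- The generating function `X(t) = ∑ X_n t^n`, the sum starting at `n = 0`. -/
noncomputable def fullGenFun : PowerSeries ℤ :=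
  PowerSeries.mk fun n => (numFull n : ℤ)

/-! Group the two medial vertices between consecutive boundary vertices into a block. A wiring
diagram becomes a matching of the elements of `n` cyclically ordered blocks, and a dividing line
becomes a stable interval of blocks: one whose elements are matched among themselves. Stability
passes to complements, so only intervals avoiding block `0` matter: full means that no nonempty
stable interval starts at a block `1, …, n - 1`.

Scan these starting blocks in order and cut out the longest stable interval at each; what is cut out
is an arbitrary matching, and what finally remains is full (`noStableStart_insert_iff`,
`card_noStableStart_eq_sum`). With `F = ∑ (2m-1)‼ t^m` this says `F(t) = X(t F(t))`. Lagrange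
inversion gives (b). The recursion for odd double factorials is `F = 1 + tF + 2t²F'`; rewritten in
the variable `tF`, it becomes a differential equation for `X`, whose coefficients give (a).

For (c), a full diagram with `n ≥ 2` has no block whose two elements are partners. By
inclusion-exclusion, the proportion of matchings without such a block tends to `∑ (-1/2)^k / k! =
e^{-1/2}`. Those that are not full have a stable interval of length between `2` and `n - 2`, and a
union bound makes their proportion `O(1/n)`. -/

/-! ### Perfect matchings: gluing and counting. -/

/-- A perfect matching of the type `α`, given by the map sending each element to its partner. -/
@[ext]
structure Matching (α : Type*) where
  /-- The partner of an element. -/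
  partner : α → α
  partner_partner : ∀ p, partner (partner p) = p
  partner_ne : ∀ p, partner p ≠ p

namespace Matching

variable {α β γ : Type*}

instance [Finite α] : Finite (Matching α) :=
  Finite.of_injective Matching.partner fun _ _ h => Matching.ext h

/-- Transport of a perfect matching along an equivalence. -/
def congr (e : α ≃ β) : Matching α ≃ Matching β where
  toFun M := ⟨fun p => e (M.partner (e.symm p)), fun p => by simp [M.partner_partner],
    fun p h => M.partner_ne (e.symm p) (e.injective (by simpa using h))⟩
  invFun M := ⟨fun p => e.symm (M.partner (e p)), fun p => by simp [M.partner_partner],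
    fun p h => M.partner_ne (e p) (e.symm.injective (by simpa using h))⟩
  left_inv M := by ext; simp
  right_inv M := by ext; simp

/-- The union of matchings of two complementary parts. -/
def glue (e : α ⊕ β ≃ γ) (f : Matching α) (g : Matching β) : Matching γ where
  partner p := e (Sum.map f.partner g.partner (e.symm p))
  partner_partner p := by
    obtain ⟨x, rfl⟩ := e.surjective p
    rcases x with a | b <;> simp [f.partner_partner, g.partner_partner]
  partner_ne p := by
    obtain ⟨x, rfl⟩ := e.surjective p
    rcases x with a | b <;> simp [f.partner_ne, g.partner_ne]

@[simp]
theorem glue_partner_inl (e : α ⊕ β ≃ γ) (f : Matching α) (g : Matching β) (a : α) :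
    (glue e f g).partner (e (.inl a)) = e (.inl (f.partner a)) := by
  simp [glue]

@[simp]
theorem glue_partner_inr (e : α ⊕ β ≃ γ) (f : Matching α) (g : Matching β) (b : β) :
    (glue e f g).partner (e (.inr b)) = e (.inr (g.partner b)) := by
  simp [glue]

theorem glue_injective (e : α ⊕ β ≃ γ) {f f' : Matching α} {g g' : Matching β}
    (h : glue e f g = glue e f' g') : f = f' ∧ g = g' := by
  constructor
  · ext a
    have := congrArg (fun M => M.partner (e (.inl a))) h
    simpa using this
  · ext b
    have := congrArg (fun M => M.partner (e (.inr b))) h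
    simpa using this

theorem exists_eq_glue (e : α ⊕ β ≃ γ) (M : Matching γ)
    (h : ∀ a, ∃ a', M.partner (e (.inl a)) = e (.inl a')) : ∃ f g, M = glue e f g := by
  have h' : ∀ b, ∃ b', M.partner (e (.inr b)) = e (.inr b') := by
    intro b
    obtain ⟨x, hx⟩ := e.surjective (M.partner (e (.inr b)))
    rcases x with a | b'
    · obtain ⟨a', ha'⟩ := h a
      rw [hx, M.partner_partner] at ha'
      simp at ha'
    · exact ⟨b', hx.symm⟩
  choose f hf using h
  choose g hg using h'
  refine ⟨⟨f, fun a => ?_, fun a ha => ?_⟩, ⟨g, fun b => ?_, fun b hb => ?_⟩, ?_⟩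
  · have := M.partner_partner (e (.inl a))
    simpa [hf] using this
  · have := M.partner_ne (e (.inl a))
    simp [hf, ha] at this
  · have := M.partner_partner (e (.inr b))
    simpa [hg] using this
  · have := M.partner_ne (e (.inr b))
    simp [hg, hb] at this
  · ext p
    obtain ⟨x, rfl⟩ := e.surjective p
    rcases x with a | b <;> simp [hf, hg]

theorem card_subtype_eq_mul (e : α ⊕ β ≃ γ) (P : Matching γ → Prop) (R : Matching β → Prop)
    (h : ∀ M, P M → ∀ a, ∃ a', M.partner (e (.inl a)) = e (.inl a'))
    (hPR : ∀ f g, P (glue e f g) ↔ R g) :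
    Nat.card {M // P M} = Nat.card (Matching α) * Nat.card {g // R g} := by
  rw [← Nat.card_prod]
  refine (Nat.card_congr (Equiv.ofBijective
    (fun x : Matching α × {g // R g} => (⟨glue e x.1 x.2.1, (hPR _ _).2 x.2.2⟩ : {M // P M}))
    ⟨?_, ?_⟩)).symm
  · rintro ⟨f, g, hg⟩ ⟨f', g', hg'⟩ hfg
    obtain ⟨rfl, rfl⟩ := glue_injective e (Subtype.ext_iff.1 hfg)
    rfl
  · rintro ⟨M, hM⟩
    obtain ⟨f, g, rfl⟩ := exists_eq_glue e M (h M hM)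
    exact ⟨⟨f, g, (hPR _ _).1 hM⟩, rfl⟩

theorem card_extending (e : α ⊕ β ≃ γ) (f : Matching α) :
    Nat.card {M : Matching γ // ∀ a, M.partner (e (.inl a)) = e (.inl (f.partner a))} =
      Nat.card (Matching β) := by
  refine (Nat.card_congr (Equiv.ofBijective (fun g : Matching β =>
    (⟨glue e f g, fun a => by simp⟩ :
      {M : Matching γ // ∀ a, M.partner (e (.inl a)) = e (.inl (f.partner a))}))
    ⟨?_, ?_⟩)).symm
  · intro g g' hg
    exact (glue_injective e (Subtype.ext_iff.1 hg)).2
  · rintro ⟨M, hM⟩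
    obtain ⟨f', g, rfl⟩ := exists_eq_glue e M fun a => ⟨_, hM a⟩
    have : f' = f := by
      ext a
      simpa using hM a
    subst this
    exact ⟨g, rfl⟩

/-- The matching of a type `ι × Bool` in which the two elements of each fibre are partners. -/
def fibrewise (ι : Type*) : Matching (ι × Bool) where
  partner p := (p.1, !p.2)
  partner_partner p := by simp
  partner_ne p h := by
    have := congrArg Prod.snd h
    simp at this

/-- Fixing one pair leaves an arbitrary matching of the other elements; this drives the double
factorial count. -/
theorem card_partner_eq [Finite α] {x y : α} (hxy : y ≠ x) :
    Nat.card {M : Matching α // M.partner x = y} =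
      Nat.card (Matching {z // z ≠ x ∧ z ≠ y}) := by
  classical
  let ψ : (Unit × Bool) ⊕ {z // z ≠ x ∧ z ≠ y} → α :=
    Sum.elim (fun b => if b.2 then y else x) Subtype.val
  have hψ : Function.Bijective ψ := by
    constructor
    · rintro (⟨_, b⟩ | ⟨z, hz⟩) (⟨_, b'⟩ | ⟨z', hz'⟩) h
      · cases b <;> cases b' <;>
          first | rfl | exact absurd h hxy | exact absurd h.symm hxy
      · cases b
        · exact absurd h.symm hz'.1
        · exact absurd h.symm hz'.2
      · cases b'
        · exact absurd h hz.1
        · exact absurd h hz.2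
      · exact congrArg Sum.inr (Subtype.ext h)
    · intro z
      by_cases hx : z = x
      · exact ⟨.inl ((), false), by simp [ψ, hx]⟩
      · by_cases hy : z = y
        · exact ⟨.inl ((), true), by simp [ψ, hy]⟩
        · exact ⟨.inr ⟨z, hx, hy⟩, rfl⟩
  rw [← card_extending (Equiv.ofBijective ψ hψ) (fibrewise Unit)]
  refine Nat.card_congr (Equiv.subtypeEquivRight fun M => ?_)
  constructor
  · rintro h ⟨_, b⟩
    cases b
    · simpa [ψ, fibrewise] using h
    · simpa [ψ, fibrewise, h] using M.partner_partner x
  · intro h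
    simpa [ψ, fibrewise] using h ((), false)

theorem card_eq_doubleFactorial [Finite α] (m : ℕ) (h : Nat.card α = 2 * m) :
    Nat.card (Matching α) = (2 * m - 1)‼ := by
  classical
  induction m generalizing α with
  | zero =>
    have : IsEmpty α := (Nat.card_eq_zero.1 (by simpa using h)).resolve_right (by simpa)
    have : Unique (Matching α) :=
      ⟨⟨⟨id, fun p => this.elim p, fun p => this.elim p⟩⟩, fun M => by
        ext p; exact this.elim p⟩
    simp
  | succ m ih =>
    have : Fintype α := Fintype.ofFinite α
    have hne : Nonempty α := (Nat.card_pos_iff.1 (by omega)).1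
    obtain ⟨x⟩ := hne
    let F : Matching α → {y // y ≠ x} := fun M => ⟨M.partner x, M.partner_ne x⟩
    rw [← Nat.card_congr (Equiv.sigmaFiberEquiv F), Nat.card_sigma]
    have key : ∀ y : {y // y ≠ x}, Nat.card {M : Matching α // F M = y} = (2 * m - 1)‼ := by
      rintro ⟨y, hy⟩
      simp only [F, Subtype.mk.injEq]
      rw [card_partner_eq hy, ih]
      have : ∀ z, (z ≠ x ∧ z ≠ y) ↔ z ∈ ({x, y} : Finset α)ᶜ := by simp
      rw [Nat.card_congr (Equiv.subtypeEquivRight this), Nat.card_eq_fintype_card,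
        Fintype.card_coe, Finset.card_compl, Finset.card_pair hy.symm, ← Nat.card_eq_fintype_card]
      omega
    rw [Finset.sum_congr rfl fun y _ => key y, Finset.sum_const, Finset.card_univ]
    have hc : Fintype.card {y // y ≠ x} = 2 * m + 1 := by
      rw [Fintype.card_subtype_compl, Fintype.card_subtype_eq, ← Nat.card_eq_fintype_card, h]
      omega
    rw [hc, smul_eq_mul, show 2 * (m + 1) - 1 = 2 * m + 1 by omega, Nat.doubleFactorial_add_one]

end Matching

/-! ### Stable intervals of blocks: insertion and removal. -/

namespace Matching

variable {ι κ : Type*} {m l p i j : ℕ}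

/-- A set `s` of blocks is stable if the elements of its blocks are matched among themselves. -/
def StableOn (M : Matching (ι × Bool)) (s : Set ι) : Prop :=
  ∀ x, x.1 ∈ s → (M.partner x).1 ∈ s

theorem StableOn.iff {M : Matching (ι × Bool)} {s : Set ι} (h : M.StableOn s) (x : ι × Bool) :
    (M.partner x).1 ∈ s ↔ x.1 ∈ s :=
  ⟨fun hx => by simpa [M.partner_partner] using h _ hx, h x⟩

theorem StableOn.compl {M : Matching (ι × Bool)} {s : Set ι} (h : M.StableOn s) :
    M.StableOn sᶜ := fun x hx hx' => hx ((h.iff x).1 hx')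

/-- The interval `[i, j)` of blocks is stable. -/
def IsStable (M : Matching (Fin m × Bool)) (i j : ℕ) : Prop :=
  M.StableOn {b | i ≤ b.val ∧ b.val < j}

/-- No nonempty stable interval of blocks starts at one of the blocks `1, …, p - 1`. -/
def NoStableStart (p : ℕ) (M : Matching (Fin m × Bool)) : Prop :=
  ∀ i j, 1 ≤ i → i < p → i < j → j ≤ m → ¬ M.IsStable i j

/-- A splitting of the set of blocks gives a splitting of the set of elements of the blocks. -/
def blockEquiv {ν : Type*} (e : ι ⊕ κ ≃ ν) : (ι × Bool) ⊕ (κ × Bool) ≃ ν × Bool :=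
  (Equiv.sumProdDistrib _ _ _).symm.trans (e.prodCongr (Equiv.refl _))

@[simp]
theorem blockEquiv_inl {ν : Type*} (e : ι ⊕ κ ≃ ν) (x : ι × Bool) :
    blockEquiv e (.inl x) = (e (.inl x.1), x.2) := rfl

theorem stableOn_glue_iff {ν : Type*} (e : ι ⊕ κ ≃ ν) (f : Matching (ι × Bool))
    (g : Matching (κ × Bool)) (s : Set ν) :
    (glue (blockEquiv e) f g).StableOn s ↔
      f.StableOn {a | e (.inl a) ∈ s} ∧ g.StableOn {b | e (.inr b) ∈ s} := by
  constructor
  · intro h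
    constructor
    · intro x hx
      have := h (blockEquiv e (.inl x)) hx
      rwa [glue_partner_inl] at this
    · intro x hx
      have := h (blockEquiv e (.inr x)) hx
      rwa [glue_partner_inr] at this
  · rintro ⟨hf, hg⟩ y hy
    obtain ⟨x | x, rfl⟩ := (blockEquiv e).surjective y
    · rw [glue_partner_inl]
      exact hf x hy
    · rw [glue_partner_inr]
      exact hg x hy

/-- The splitting of `m + l` blocks into the `l` blocks `p, …, p + l - 1` and the others. -/
noncomputable def insertBlocks (p m l : ℕ) (hp : p ≤ m) : Fin l ⊕ Fin m ≃ Fin (m + l) :=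
  Equiv.ofBijective
    (Sum.elim (fun a => ⟨p + a.val, by omega⟩)
      (fun b => ⟨if b.val < p then b.val else b.val + l, by split_ifs <;> omega⟩)) <| by
    rw [Fintype.bijective_iff_injective_and_card]
    refine ⟨?_, by simp [add_comm]⟩
    rintro (a | a) (b | b) h <;> simp only [Sum.elim_inl, Sum.elim_inr, Fin.mk.injEq] at h
    · exact congrArg Sum.inl (Fin.ext (by omega))
    · split_ifs at h <;> omega
    · split_ifs at h <;> omega
    · exact congrArg Sum.inr (Fin.ext (by split_ifs at h <;> omega))

theorem insertBlocks_inl_val (hp : p ≤ m) (a : Fin l) :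
    (insertBlocks p m l hp (.inl a)).val = p + a.val := rfl

/-- Insertion of the blocks of `f` into those of `g`, at position `p`. -/
noncomputable abbrev insert (hp : p ≤ m) (f : Matching (Fin l × Bool))
    (g : Matching (Fin m × Bool)) : Matching (Fin (m + l) × Bool) :=
  glue (blockEquiv (insertBlocks p m l hp)) f g

theorem isStable_insert_iff (hp : p ≤ m) (f : Matching (Fin l × Bool))
    (g : Matching (Fin m × Bool)) :
    (insert hp f g).IsStable i j ↔
      f.StableOn {a | i ≤ p + a.val ∧ p + a.val < j} ∧
      g.StableOn {b | i ≤ (if b.val < p then b.val else b.val + l) ∧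
        (if b.val < p then b.val else b.val + l) < j} :=
  stableOn_glue_iff _ f g _

theorem IsStable.of_insert (hp : p ≤ m) {f : Matching (Fin l × Bool)}
    {g : Matching (Fin m × Bool)} {i' j' : ℕ} (h : (insert hp f g).IsStable i j)
    (hij : ∀ b < m, (i ≤ (if b < p then b else b + l) ∧ (if b < p then b else b + l) < j) ↔
      i' ≤ b ∧ b < j') : g.IsStable i' j' := by
  have := ((isStable_insert_iff hp f g).1 h).2
  have hs : {b : Fin m | i ≤ (if b.val < p then b.val else b.val + l) ∧
        (if b.val < p then b.val else b.val + l) < j} = {b | i' ≤ b.val ∧ b.val < j'} := by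
    ext b
    exact hij b.val b.isLt
  rwa [hs] at this

theorem IsStable.insert (hp : p ≤ m) {f : Matching (Fin l × Bool)}
    {g : Matching (Fin m × Bool)} {i' j' : ℕ} (h : g.IsStable i j)
    (hij : ∀ b < m, (i' ≤ (if b < p then b else b + l) ∧ (if b < p then b else b + l) < j') ↔
      i ≤ b ∧ b < j)
    (hf : (∀ a < l, i' ≤ p + a ∧ p + a < j') ∨ ∀ a < l, ¬ (i' ≤ p + a ∧ p + a < j')) :
    (Matching.insert hp f g).IsStable i' j' := by
  refine (isStable_insert_iff hp f g).2 ⟨?_, ?_⟩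
  · intro x hx
    rcases hf with hf | hf
    · exact hf _ (Fin.isLt _)
    · exact absurd hx (hf _ (Fin.isLt _))
  · have hs : {b : Fin m | i' ≤ (if b.val < p then b.val else b.val + l) ∧
        (if b.val < p then b.val else b.val + l) < j'} = {b | i ≤ b.val ∧ b.val < j} := by
      ext b
      exact hij b.val b.isLt
    rwa [hs]

theorem isStable_insert_self (hp : p ≤ m) (f : Matching (Fin l × Bool))
    (g : Matching (Fin m × Bool)) : (insert hp f g).IsStable p (p + l) := by
  refine (isStable_insert_iff hp f g).2 ⟨fun x _ => ?_, fun x hx => ?_⟩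
  · exact ⟨by omega, by simp⟩
  · simp only [Set.mem_ofPred_eq] at hx
    split_ifs at hx <;> omega

/-- Stable intervals of `g` starting before `p` lift to the insertion, widened by `l` if they pass
`p`. One starting at `p` lifts to a stable interval longer than the inserted one, so maximality of
`l` is what excludes it. Conversely, stable intervals of the insertion restrict to `g`. -/
theorem noStableStart_insert_iff (hp1 : 1 ≤ p) (hp : p ≤ m) (f : Matching (Fin l × Bool))
    (g : Matching (Fin m × Bool)) :
    (NoStableStart p (insert hp f g) ∧ (insert hp f g).IsStable p (p + l) ∧
      ∀ l', l < l' → l' ≤ m + l - p → ¬ (insert hp f g).IsStable p (p + l')) ↔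
    NoStableStart (p + 1) g := by
  constructor
  · rintro ⟨hC, -, hmax⟩ i j h1 hip hij hjm hst
    rcases Nat.lt_or_ge i p with hi | hi
    · rcases Nat.lt_or_ge p j with hj | hj
      · refine hC i (j + l) h1 hi (by omega) (by omega) (hst.insert hp (fun b hb => ?_) (.inl ?_))
        · split_ifs <;> omega
        · omega
      · refine hC i j h1 hi hij (by omega) (hst.insert hp (fun b hb => ?_) (.inr ?_))
        · split_ifs <;> omega
        · omega
    · obtain rfl : i = p := by omega
      refine hmax (j - i + l) (by omega) (by omega)
        (hst.insert hp (fun b hb => ?_) (.inl ?_))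
      · split_ifs <;> omega
      · omega
  · intro hC
    refine ⟨fun i j h1 hip hij hjm hst => ?_, isStable_insert_self hp f g,
      fun l' hl hl' hst => ?_⟩
    · refine hC i (if j ≤ p then j else if j ≤ p + l then p else j - l) h1 (by omega)
        (by split_ifs <;> omega) (by split_ifs <;> omega) (hst.of_insert hp fun b hb => ?_)
      split_ifs <;> omega
    · refine hC p (p + l' - l) hp1 (by omega) (by omega) (by omega)
        (hst.of_insert hp fun b hb => ?_)
      split_ifs <;> omega

theorem exists_partner_insertBlocks (hp : p ≤ m) (M : Matching (Fin (m + l) × Bool))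
    (h : M.IsStable p (p + l)) (a : Fin l × Bool) :
    ∃ a', M.partner (blockEquiv (insertBlocks p m l hp) (.inl a)) =
      blockEquiv (insertBlocks p m l hp) (.inl a') := by
  have := h (blockEquiv (insertBlocks p m l hp) (.inl a))
    ⟨by simp [insertBlocks_inl_val], by simp [insertBlocks_inl_val]⟩
  obtain ⟨h1, h2⟩ := this
  refine ⟨(⟨(M.partner (blockEquiv (insertBlocks p m l hp) (.inl a))).1.val - p, by omega⟩,
    (M.partner (blockEquiv (insertBlocks p m l hp) (.inl a))).2), ?_⟩
  refine Prod.ext (Fin.ext ?_) rfl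
  have := insertBlocks_inl_val hp (⟨(M.partner
    (blockEquiv (insertBlocks p m l hp) (.inl a))).1.val - p, by omega⟩ : Fin l)
  exact (this.trans (Nat.add_sub_cancel' h1)).symm

theorem card_blocks (m : ℕ) : Nat.card (Matching (Fin m × Bool)) = (2 * m - 1)‼ :=
  card_eq_doubleFactorial m (by simp [mul_comm])

/-- The number of matchings of `l + m` blocks with a given stable interval of `l` blocks. -/
theorem card_isStable (hp : p ≤ m) :
    Nat.card {M : Matching (Fin (m + l) × Bool) // M.IsStable p (p + l)} =
      (2 * l - 1)‼ * (2 * m - 1)‼ := by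
  rw [card_subtype_eq_mul (blockEquiv (insertBlocks p m l hp)) (fun M => M.IsStable p (p + l))
    (fun _ => True) (fun M hM => exists_partner_insertBlocks hp M hM)
    (fun f g => by simp [isStable_insert_self hp f g]), card_blocks,
    Nat.card_congr (Equiv.subtypeUnivEquiv fun _ => trivial), card_blocks]

theorem card_noStableStart_of_longest (hp1 : 1 ≤ p) (hp : p ≤ m) :
    Nat.card {M : Matching (Fin (m + l) × Bool) // NoStableStart p M ∧ M.IsStable p (p + l) ∧
      ∀ l', l < l' → l' ≤ m + l - p → ¬ M.IsStable p (p + l')} =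
    (2 * l - 1)‼ * Nat.card {M : Matching (Fin m × Bool) // NoStableStart (p + 1) M} := by
  rw [card_subtype_eq_mul (blockEquiv (insertBlocks p m l hp)) _ (NoStableStart (p + 1))
    (fun M hM => exists_partner_insertBlocks hp M hM.2.1)
    (fun f g => noStableStart_insert_iff hp1 hp f g), card_blocks]

-- Sort the matchings by the length `l` of the longest stable interval starting at `p`, possibly
-- empty, and remove that interval.
open Classical in
theorem card_noStableStart (hp1 : 1 ≤ p) (hp : p ≤ m) :
    Nat.card {M : Matching (Fin m × Bool) // NoStableStart p M} =
      ∑ l ∈ Finset.range (m - p + 1), (2 * l - 1)‼ *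
        Nat.card {M : Matching (Fin (m - l) × Bool) // NoStableStart (p + 1) M} := by
  let F : {M : Matching (Fin m × Bool) // NoStableStart p M} → Fin (m - p + 1) := fun M =>
    ⟨Nat.findGreatest (fun l => M.1.IsStable p (p + l)) (m - p),
      Nat.lt_succ_of_le (Nat.findGreatest_le _)⟩
  rw [← Nat.card_congr (Equiv.sigmaFiberEquiv F), Nat.card_sigma,
    ← Fin.sum_univ_eq_sum_range (fun l => (2 * l - 1)‼ *
        Nat.card {M : Matching (Fin (m - l) × Bool) // NoStableStart (p + 1) M})]
  refine Finset.sum_congr rfl fun l _ => ?_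
  obtain ⟨l, hl⟩ := l
  obtain ⟨k, rfl⟩ : ∃ k, m = k + l := ⟨m - l, by omega⟩
  rw [Nat.add_sub_cancel, ← card_noStableStart_of_longest hp1 (by omega)]
  have h : ∀ M, F M = ⟨l, hl⟩ ↔ M.1.IsStable p (p + l) ∧
      ∀ l', l < l' → l' ≤ k + l - p → ¬ M.1.IsStable p (p + l') := by
    intro M
    simp only [F, Fin.mk.injEq, Nat.findGreatest_eq_iff]
    constructor
    · rintro ⟨-, h1, h2⟩
      refine ⟨?_, fun l' h h' => h2 h h'⟩
      -- `Nat.findGreatest` also returns `0` when nothing is found; this agrees with the empty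
      -- interval being stable.
      rcases Nat.eq_zero_or_pos l with rfl | h0
      · exact fun x hx => absurd hx.2 (by have := hx.1; omega)
      · exact h1 h0.ne'
    · rintro ⟨h1, h2⟩
      exact ⟨by omega, fun _ => h1, fun _ h h' => h2 h h'⟩
  rw [Nat.card_congr (Equiv.subtypeEquivRight h)]
  exact Nat.card_congr (Equiv.subtypeSubtypeEquivSubtypeInter (NoStableStart p)
    (fun M : Matching (Fin (k + l) × Bool) => M.IsStable p (p + l) ∧
      ∀ l', l < l' → l' ≤ k + l - p → ¬ M.IsStable p (p + l')))

theorem card_noStableStart_one :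
    Nat.card {M : Matching (Fin m × Bool) // NoStableStart 1 M} = (2 * m - 1)‼ := by
  rw [← card_blocks]
  exact Nat.card_congr (Equiv.subtypeUnivEquiv fun M i j h1 h2 => by omega)

end Matching

/-! ### Wiring diagrams as matchings of blocks. -/

namespace WiringDiagram

variable {n : ℕ}

/-- The medial boundary vertices between two consecutive boundary vertices form a block; the
medial boundary vertices `2 * k + 1` and `2 * k + 2` form the block `k`, where `2 * n` is `0`. -/
noncomputable def blocks (n : ℕ) : Fin (2 * n) ≃ Fin n × Bool :=
  Equiv.ofBijective (fun p => (⟨if p.val = 0 then n - 1 else (p.val - 1) / 2, by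
    split_ifs <;> omega⟩, decide (p.val % 2 = 1))) <| by
    rw [Fintype.bijective_iff_injective_and_card]
    refine ⟨?_, by simp [mul_comm]⟩
    intro p q h
    simp only [Prod.mk.injEq, Fin.mk.injEq, decide_eq_decide] at h
    refine Fin.ext ?_
    obtain ⟨h1, h2⟩ := h
    split_ifs at h1 <;> omega

theorem blocks_fst_val (p : Fin (2 * n)) :
    (blocks n p).1.val = if p.val = 0 then n - 1 else (p.val - 1) / 2 := rfl

/-- A wiring diagram as a matching of the elements of the blocks. -/
noncomputable def blockMatching (n : ℕ) : WiringDiagram n ≃ Matching (Fin n × Bool) where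
  toFun W := Matching.congr (blocks n) ⟨W.partner, W.partner_partner, W.partner_ne⟩
  invFun M := ⟨((Matching.congr (blocks n)).symm M).partner,
    ((Matching.congr (blocks n)).symm M).partner_partner,
    ((Matching.congr (blocks n)).symm M).partner_ne⟩
  left_inv W := by ext; simp
  right_inv M := (Matching.congr (blocks n)).apply_symm_apply M

theorem blockMatching_partner (W : WiringDiagram n) (p : Fin (2 * n)) :
    (blockMatching n W).partner (blocks n p) = blocks n (W.partner p) := by
  simp [blockMatching, Matching.congr]

theorem innerSide_iff {i j : Fin n} (hij : i ≠ j) (p : Fin (2 * n)) :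
    InnerSide i j p ↔
      (min i j).val ≤ (blocks n p).1.val ∧ (blocks n p).1.val < (max i j).val := by
  have h : (min i j).val < (max i j).val := by
    rcases lt_or_gt_of_ne hij with h | h
    · rw [min_eq_left h.le, max_eq_right h.le]; exact h
    · rw [min_eq_right h.le, max_eq_left h.le]; exact h
  rw [InnerSide, blocks_fst_val]
  split_ifs <;> omega

theorem isDividingLine_iff (W : WiringDiagram n) {i j : Fin n} (hij : i ≠ j) :
    W.IsDividingLine i j ↔ (blockMatching n W).IsStable (min i j).val (max i j).val := by
  simp only [IsDividingLine, OppositeSides, not_exists, not_not, innerSide_iff hij, ne_eq, hij,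
    not_false_eq_true, true_and]
  constructor
  · intro h x hx
    obtain ⟨p, rfl⟩ := (blocks n).surjective x
    rw [blockMatching_partner]
    exact (h p).1 hx
  · intro h p
    have := h.iff (blocks n p)
    rw [blockMatching_partner] at this
    exact this.symm

end WiringDiagram

namespace Matching

variable {n : ℕ}

theorem isStable_of_isStable_compl {M : Matching (Fin n × Bool)} {i j k l : ℕ}
    (h : M.IsStable i j) (hs : ∀ b < n, (k ≤ b ∧ b < l) ↔ ¬ (i ≤ b ∧ b < j)) :
    M.IsStable k l := by
  intro x hx
  exact (hs _ (Fin.isLt _)).2 (h.compl x ((hs _ (Fin.isLt _)).1 hx))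

/-- This trades an interval containing block `0` for one avoiding it, so lines through `V 0` also
fit `NoStableStart`. -/
theorem isStable_initial_iff {M : Matching (Fin n × Bool)} {j : ℕ} :
    M.IsStable 0 j ↔ M.IsStable j n :=
  ⟨fun h => isStable_of_isStable_compl h fun b hb => by omega,
    fun h => isStable_of_isStable_compl h fun b hb => by omega⟩

end Matching

namespace WiringDiagram

variable {n : ℕ}

theorem isFull_iff (W : WiringDiagram n) :
    W.IsFull ↔ (blockMatching n W).NoStableStart n := by
  constructor
  · intro h i j h1 hin hij hjn hst
    rcases hjn.lt_or_eq with hj | rfl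
    · have hne : (⟨i, hin⟩ : Fin n) ≠ ⟨j, hj⟩ := by simp; omega
      refine h ⟨⟨i, hin⟩, ⟨j, hj⟩, (isDividingLine_iff W hne).2 ?_⟩
      rwa [min_eq_left (by simpa using hij.le), max_eq_right (by simpa using hij.le)]
    · have hne : (⟨0, by omega⟩ : Fin j) ≠ ⟨i, hin⟩ := by simp; omega
      refine h ⟨⟨0, by omega⟩, ⟨i, hin⟩, (isDividingLine_iff W hne).2 ?_⟩
      rw [min_eq_left (by simp), max_eq_right (by simp)]
      exact Matching.isStable_initial_iff.2 hst
  · rintro h ⟨i, j, hd⟩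
    have hst := (isDividingLine_iff W hd.1).1 hd
    have hlt : (min i j).val < (max i j).val := by
      rcases lt_or_gt_of_ne hd.1 with h | h
      · rw [min_eq_left h.le, max_eq_right h.le]; exact h
      · rw [min_eq_right h.le, max_eq_left h.le]; exact h
    rcases Nat.eq_zero_or_pos (min i j).val with h0 | h0
    · rw [h0] at hst
      exact h _ _ (by omega) (Fin.isLt _) (Fin.isLt _) le_rfl (Matching.isStable_initial_iff.1 hst)
    · exact h _ _ h0 (Fin.isLt _) hlt (Fin.isLt _).le hst

end WiringDiagram

theorem numFull_eq_card {n p : ℕ} (hp : n ≤ p) :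
    numFull n = Nat.card {M : Matching (Fin n × Bool) // M.NoStableStart p} := by
  refine Nat.card_congr ((WiringDiagram.blockMatching n).subtypeEquiv fun W => ?_)
  rw [WiringDiagram.isFull_iff]
  exact ⟨fun h i j h1 _ hij hj => h i j h1 (by omega) hij hj,
    fun h i j h1 _ hij hj => h i j h1 (by omega) hij hj⟩

theorem numFull_zero : numFull 0 = 1 := by
  rw [numFull_eq_card (p := 1) (by omega), Matching.card_noStableStart_one]
  simp

theorem numFull_one : numFull 1 = 1 := by
  rw [numFull_eq_card (p := 1) (by omega), Matching.card_noStableStart_one]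
  simp

/-! ### The functional equation `F(t) = X(t F(t))`. -/

/-- The generating function of the odd double factorials `(2 * m - 1)‼`. -/
noncomputable def oddFactGenFun : PowerSeries ℤ :=
  PowerSeries.mk fun m => (((2 * m - 1)‼ : ℕ) : ℤ)

open PowerSeries

/-- A full core of `p + k` blocks remains after cutting at the `k + 1` positions `p, …, p + k`; each
cut contributes one factor `F`. The induction performs the cut at `p` and passes to `p + 1`. -/
theorem card_noStableStart_eq_sum (d p : ℕ) (hp : 1 ≤ p) :
    (Nat.card {M : Matching (Fin (p + d) × Bool) // M.NoStableStart p} : ℤ) =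
      ∑ k ∈ Finset.range (d + 1),
        (numFull (p + k) : ℤ) * coeff (d - k) (oddFactGenFun ^ (k + 1)) := by
  induction d using Nat.strong_induction_on generalizing p with
  | _ d ih =>
    rw [Matching.card_noStableStart hp (by omega), Nat.add_sub_cancel_left, Finset.sum_range_succ,
      Finset.sum_range_succ', Nat.add_sub_cancel, ← numFull_eq_card (by omega)]
    -- The split-off term `l = d` leaves exactly `p` blocks and matches `k = 0`; the terms `l < d`
    -- fall under the induction hypothesis.
    have hstep : ∀ l ∈ Finset.range d, ((((2 * l - 1)‼ : ℕ) : ℤ) *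
        (Nat.card {M : Matching (Fin (p + d - l) × Bool) // M.NoStableStart (p + 1)} : ℤ)) =
        ∑ k ∈ Finset.range (d - l), (((2 * l - 1)‼ : ℕ) : ℤ) * ((numFull (p + (k + 1)) : ℤ) *
          coeff (d - (k + 1) - l) (oddFactGenFun ^ (k + 1))) := by
      intro l hl
      rw [Finset.mem_range] at hl
      have := ih (d - 1 - l) (by omega) (p + 1) (by omega)
      rw [show p + 1 + (d - 1 - l) = p + d - l by omega] at this
      rw [this, Finset.mul_sum, show d - 1 - l + 1 = d - l by omega]
      refine Finset.sum_congr rfl fun k hk => ?_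
      rw [show p + 1 + k = p + (k + 1) by omega, show d - 1 - l - k = d - (k + 1) - l by omega]
    push_cast
    rw [Finset.sum_congr rfl hstep]
    congr 1
    · have hmul : ∀ k e, coeff e (oddFactGenFun ^ (k + 1 + 1)) = ∑ i ∈ Finset.range (e + 1),
          coeff i oddFactGenFun * coeff (e - i) (oddFactGenFun ^ (k + 1)) := by
        intro k e
        rw [pow_succ', coeff_mul, Finset.Nat.sum_antidiagonal_eq_sum_range_succ
          (fun i j => coeff i oddFactGenFun * coeff j (oddFactGenFun ^ (k + 1)))]
      simp only [hmul, Finset.mul_sum]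
      rw [Finset.sum_sigma', Finset.sum_sigma']
      refine Finset.sum_bij' (fun x _ => ⟨x.2, x.1⟩) (fun x _ => ⟨x.2, x.1⟩) ?_ ?_ ?_ ?_ ?_
      · rintro ⟨a, b⟩ h
        simp only [Finset.mem_sigma, Finset.mem_range] at h ⊢
        omega
      · rintro ⟨a, b⟩ h
        simp only [Finset.mem_sigma, Finset.mem_range] at h ⊢
        omega
      · intros; rfl
      · intros; rfl
      · rintro ⟨a, b⟩ h
        simp only [oddFactGenFun, coeff_mk]
        ring
    · simp [oddFactGenFun, mul_comm]

theorem coeff_oddFactGenFun_eq_sum (m : ℕ) :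
    coeff m oddFactGenFun = ∑ k ∈ Finset.range (m + 1),
      coeff k fullGenFun * coeff (m - k) (oddFactGenFun ^ k) := by
  rcases m with _ | d
  · simp [oddFactGenFun, fullGenFun, numFull_zero]
  · have h := card_noStableStart_eq_sum d 1 le_rfl
    rw [Matching.card_noStableStart_one] at h
    rw [Finset.sum_range_succ', oddFactGenFun, coeff_mk, ← oddFactGenFun, add_comm d 1, h]
    simp [fullGenFun, coeff_one, add_comm]

/-! ### Substitution of `t F(t)` and Lagrange inversion. -/

section PowerSeriesLemmas

variable {R : Type*} [CommRing R]

theorem hasSubst_X_mul (F : PowerSeries R) : HasSubst (X * F) :=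
  HasSubst.of_constantCoeff_zero' (by simp)

theorem coeff_subst_X_mul (F P : PowerSeries R) (m : ℕ) :
    coeff m (P.subst (X * F)) =
      ∑ k ∈ Finset.range (m + 1), coeff k P * coeff (m - k) (F ^ k) := by
  rw [coeff_subst' (hasSubst_X_mul F), finsum_eq_sum_of_support_subset (s := Finset.range (m + 1))]
  · refine Finset.sum_congr rfl fun k hk => ?_
    rw [mul_pow, coeff_X_pow_mul', if_pos (by simpa [Nat.lt_succ_iff] using hk), smul_eq_mul]
  · intro k hk
    by_contra h
    refine hk ?_
    rw [Finset.mem_coe, Finset.mem_range] at h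
    simp only
    rw [mul_pow, coeff_X_pow_mul', if_neg (by omega), smul_zero]

theorem coeff_X_mul_derivative (f : PowerSeries R) (m : ℕ) :
    coeff m (X * d⁄dX R f) = m * coeff m f := by
  rcases m with _ | m
  · simp
  · rw [coeff_succ_X_mul, coeff_derivative]
    push_cast
    ring

/-- Substitution is triangular on coefficients, with `1` on the diagonal. -/
theorem eq_zero_of_subst_X_mul_eq_zero {F P : PowerSeries R} (hF : constantCoeff F = 1)
    (h : P.subst (X * F) = (0 : PowerSeries R)) : P = 0 := by
  ext m
  induction m using Nat.strong_induction_on with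
  | _ m ih =>
    have := congrArg (coeff m) h
    rw [coeff_subst_X_mul, Finset.sum_range_succ, Finset.sum_eq_zero] at this
    · simpa [hF] using this
    · intro k hk
      rw [ih k (Finset.mem_range.1 hk)]
      simp

/-- **Lagrange inversion** for the solution `F` of `F(t) = P(t F(t))`. -/
theorem lagrange_inversion [IsDomain R] [CharZero R] {F P : PowerSeries R}
    (h : F = P.subst (X * F)) (m r : ℕ) :
    ((m + r : ℕ) : R) * coeff m (F ^ r) = r * coeff m (P ^ (m + r)) := by
  have hpow : ∀ m r, coeff m (F ^ r) =
      ∑ k ∈ Finset.range (m + 1), coeff k (P ^ r) * coeff (m - k) (F ^ k) := by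
    intro m r
    rw [← coeff_subst_X_mul, subst_pow (hasSubst_X_mul F), ← h]
  induction m using Nat.strong_induction_on generalizing r with
  | _ m ih =>
    rcases Nat.eq_zero_or_pos m with rfl | hm
    · rw [hpow]
      simp
    have hm0 : (m : R) ≠ 0 := Nat.cast_ne_zero.2 hm.ne'
    -- Expand `F^r = P^r(tF)`. For `k > 0` the induction hypothesis turns `m [t^(m-k)] F^k` into `k
    -- [t^(m-k)] P^m`, and the weight `k` becomes the operator `t d/dt` on `P^r`.
    have h1 : (m : R) * coeff m (F ^ r) = coeff m (X * d⁄dX R (P ^ r) * P ^ m) := by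
      rw [coeff_mul, Finset.Nat.sum_antidiagonal_eq_sum_range_succ
        (fun i j => coeff i (X * d⁄dX R (P ^ r)) * coeff j (P ^ m)), hpow, Finset.mul_sum]
      refine Finset.sum_congr rfl fun k hk => ?_
      have hk' : k ≤ m := by simpa [Nat.lt_succ_iff] using hk
      have h2 : (m : R) * coeff (m - k) (F ^ k) = k * coeff (m - k) (P ^ m) := by
        rcases Nat.eq_zero_or_pos k with rfl | hk0
        · simp [coeff_one, hm.ne']
        · have := ih (m - k) (by omega) k
          rwa [Nat.sub_add_cancel hk'] at this
      rw [coeff_X_mul_derivative]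
      linear_combination coeff k (P ^ r) * h2
    have h3 : ((m + r : ℕ) : PowerSeries R) * (X * d⁄dX R (P ^ r) * P ^ m) =
        (r : PowerSeries R) * (X * d⁄dX R (P ^ (m + r))) := by
      rcases r with _ | s
      · simp
      · rw [derivative_pow, derivative_pow, ← add_assoc, Nat.add_sub_cancel, Nat.add_sub_cancel,
          pow_add]
        ring
    have h4 := congrArg (coeff m) h3
    have hc : ∀ (n : ℕ) (f : PowerSeries R), coeff m ((n : PowerSeries R) * f) =
        n * coeff m f := by
      intro n f
      rw [← map_natCast (C (R := R)) n, coeff_C_mul]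
    rw [hc, hc, ← h1, coeff_X_mul_derivative] at h4
    refine mul_left_cancel₀ hm0 ?_
    linear_combination h4

end PowerSeriesLemmas

/-! ### Coefficients of powers of `X(t)`, differential equation and recurrence. -/

theorem oddFactGenFun_eq_subst :
    oddFactGenFun = fullGenFun.subst (X * oddFactGenFun) := by
  ext m
  rw [coeff_subst_X_mul, coeff_oddFactGenFun_eq_sum]

/-- Lagrange inversion with `r = 1`. At `n = 1` the truncated `2 * n - 3` is `0`, and `0‼ = 1`
agrees with the convention `(-1)!! = 1`. -/
theorem coeff_fullGenFun_pow {n : ℕ} (hn : 1 ≤ n) :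
    coeff (n - 1) (fullGenFun ^ n) = (n : ℤ) * (((2 * n - 3)‼ : ℕ) : ℤ) := by
  have := lagrange_inversion oddFactGenFun_eq_subst (n - 1) 1
  rw [Nat.sub_add_cancel hn, pow_one, oddFactGenFun, coeff_mk,
    show 2 * (n - 1) - 1 = 2 * n - 3 by omega] at this
  simpa using this.symm

theorem oddFactGenFun_eq :
    oddFactGenFun = 1 + X * oddFactGenFun + 2 * (X * (X * d⁄dX ℤ oddFactGenFun)) := by
  ext m
  rw [map_add, map_add, show (2 : PowerSeries ℤ) = C 2 from rfl, coeff_C_mul]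
  rcases m with _ | m
  · simp [oddFactGenFun]
  · rw [coeff_succ_X_mul, coeff_succ_X_mul, coeff_X_mul_derivative, oddFactGenFun, coeff_mk,
      coeff_mk, show 2 * (m + 1) - 1 = 2 * m + 1 by omega, Nat.doubleFactorial_add_one, coeff_one,
      if_neg (by omega)]
    push_cast
    ring

/-- It suffices to check the identity after substituting `tF`, where `X` becomes `F` and the chain
rule gives `F' = X'(tF) (F + tF')`. Multiplying by the nonzero series `F + tF'` eliminates `X'(tF)`,
and what remains is `F²` times the equation for `F`. -/
theorem fullGenFun_differential_equation :
    fullGenFun ^ 2 - X * d⁄dX ℤ fullGenFun * fullGenFun + X * d⁄dX ℤ fullGenFun - fullGenFun -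
      X * fullGenFun - X * (X * d⁄dX ℤ fullGenFun) = 0 := by
  have hF1 : constantCoeff oddFactGenFun = 1 := by
    rw [← coeff_zero_eq_constantCoeff_apply]
    simp [oddFactGenFun]
  refine eq_zero_of_subst_X_mul_eq_zero hF1 ?_
  have hs := hasSubst_X_mul oddFactGenFun
  have hd : d⁄dX ℤ oddFactGenFun = (d⁄dX ℤ fullGenFun).subst (X * oddFactGenFun) *
      (oddFactGenFun + X * d⁄dX ℤ oddFactGenFun) := by
    conv_lhs => rw [oddFactGenFun_eq_subst, derivative_subst hs]
    rw [Derivation.leibniz, derivative_X]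
    simp only [smul_eq_mul]
    ring
  rw [← coe_substAlgHom hs]
  simp only [map_sub, map_add, map_mul, map_pow, substAlgHom_X hs]
  rw [coe_substAlgHom hs, ← oddFactGenFun_eq_subst]
  have hO := oddFactGenFun_eq
  set F := oddFactGenFun
  set Y := (d⁄dX ℤ fullGenFun).subst (X * F)
  set F' := d⁄dX ℤ F
  have hne : F + X * F' ≠ 0 := by
    intro h
    have := congrArg constantCoeff h
    simp [hF1] at this
  refine (mul_eq_zero_iff_left hne).1 ?_
  linear_combination (-(-X * F * F + X * F - X * F * (X * F))) * hd + F ^ 2 * hO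

theorem numFull_recurrence {n : ℕ} (hn : 2 ≤ n) :
    (numFull n : ℤ) = 2 * ((n : ℤ) - 1) * (numFull (n - 1) : ℤ) +
      ∑ j ∈ Finset.Icc 2 (n - 2),
        ((j : ℤ) - 1) * (numFull j : ℤ) * (numFull (n - j) : ℤ) := by
  have h := congrArg (coeff n) fullGenFun_differential_equation
  obtain ⟨k, rfl⟩ : ∃ k, n = k + 2 := ⟨n - 2, by omega⟩
  have hX : ∀ k, coeff k fullGenFun = (numFull k : ℤ) := fun k => by simp [fullGenFun]
  -- The two products combine to `∑ (1 - j) X_j X_(n-j)` with `n = k + 2`. The term `j = 1`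
  -- vanishes, and `j = 0, n - 1, n` are split off.
  have hsq : coeff (k + 2) (fullGenFun ^ 2) - coeff (k + 2) (X * d⁄dX ℤ fullGenFun * fullGenFun) =
      numFull (k + 2) - ∑ j ∈ Finset.Icc 2 k, ((j : ℤ) - 1) * numFull j * numFull (k + 2 - j)
        - k * numFull (k + 1) - (k + 1) * numFull (k + 2) := by
    rw [sq, coeff_mul, coeff_mul, ← Finset.sum_sub_distrib,
      Finset.Nat.sum_antidiagonal_eq_sum_range_succ
        (fun i j => coeff i fullGenFun * coeff j fullGenFun -
          coeff i (X * d⁄dX ℤ fullGenFun) * coeff j fullGenFun)]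
    simp only [coeff_X_mul_derivative, hX]
    rw [Finset.sum_range_succ, Finset.sum_range_succ]
    rcases k with _ | l
    · simp [numFull_zero]
      ring
    · have hIcc : ∑ j ∈ Finset.Icc 2 (l + 1), ((j : ℤ) - 1) * numFull j * numFull (l + 1 + 2 - j) =
          -∑ k ∈ Finset.range l, ((numFull (k + 1 + 1) : ℤ) * numFull (l + 1 + 2 - (k + 1 + 1)) -
            ((k + 1 + 1 : ℕ) : ℤ) * numFull (k + 1 + 1) * numFull (l + 1 + 2 - (k + 1 + 1))) := by
        rw [← Finset.Ico_add_one_right_eq_Icc, Finset.sum_Ico_eq_sum_range,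
          ← Finset.sum_neg_distrib]
        refine Finset.sum_congr rfl fun k _ => ?_
        rw [show 2 + k = k + 1 + 1 by ring]
        push_cast
        ring
      rw [Finset.sum_range_succ', Finset.sum_range_succ', hIcc]
      simp only [numFull_zero, numFull_one, Nat.sub_self, Nat.sub_zero, zero_add,
        show l + 1 + 2 - (l + 1 + 1) = 1 by omega]
      push_cast
      ring
  simp only [map_sub, map_add, coeff_succ_X_mul, coeff_derivative, hX, map_zero] at h
  rw [hsq] at h
  push_cast at h ⊢
  linear_combination h

/-! ### Matchings without fixed blocks, and comparison with full ones. -/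

namespace Matching

variable {n : ℕ}

/-- No block consists of two partners. -/
def NoFixedBlock (M : Matching (Fin n × Bool)) : Prop :=
  ∀ b, M.partner (b, false) ≠ (b, true)

theorem isStable_singleton_iff (M : Matching (Fin n × Bool)) {b : ℕ} (hb : b < n) :
    M.IsStable b (b + 1) ↔ M.partner (⟨b, hb⟩, false) = (⟨b, hb⟩, true) := by
  constructor
  · intro h
    have h1 : (M.partner (⟨b, hb⟩, false)).1 = ⟨b, hb⟩ := by
      have := h (⟨b, hb⟩, false) ⟨le_rfl, Nat.lt_succ_self b⟩
      have h1 : b ≤ (M.partner (⟨b, hb⟩, false)).1.val := this.1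
      have h2 : (M.partner (⟨b, hb⟩, false)).1.val < b + 1 := this.2
      exact Fin.ext (by simp only; omega)
    refine Prod.ext h1 ?_
    have h2 : M.partner (⟨b, hb⟩, false) ≠ (⟨b, hb⟩, false) := M.partner_ne _
    by_contra h3
    exact h2 (Prod.ext h1 (by simpa using h3))
  · rintro h ⟨c, s⟩ hx
    obtain rfl : c = ⟨b, hb⟩ := Fin.ext (by have h1 := hx.1; have h2 := hx.2; simp at *; omega)
    have h' := M.partner_partner (⟨b, hb⟩, false)
    rw [h] at h'
    cases s
    · rw [h]; exact hx
    · rw [h']; exact hx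

open Classical in
theorem card_forall_mem_fixed (t : Finset (Fin n)) :
    Nat.card {M : Matching (Fin n × Bool) // ∀ b ∈ t, M.partner (b, false) = (b, true)} =
      (2 * (n - t.card) - 1)‼ := by
  rw [← card_eq_doubleFactorial (α := {b // ¬ b ∈ t} × Bool),
    ← card_extending (blockEquiv (Equiv.sumCompl (· ∈ t))) (fibrewise {b // b ∈ t})]
  · refine Nat.card_congr (Equiv.subtypeEquivRight fun M => ?_)
    constructor
    · rintro h ⟨⟨b, hb⟩, s⟩
      have h' := M.partner_partner (b, false)
      rw [h b hb] at h'
      cases s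
      · simpa [fibrewise] using h b hb
      · simpa [fibrewise] using h'
    · intro h b hb
      simpa [fibrewise] using h (⟨b, hb⟩, false)
  · simp [Fintype.card_subtype_compl, mul_comm]

open Classical in
theorem card_noFixedBlock (n : ℕ) :
    (Nat.card {M : Matching (Fin n × Bool) // M.NoFixedBlock} : ℤ) =
      ∑ k ∈ Finset.range (n + 1), (-1) ^ k * (n.choose k : ℤ) * ((2 * (n - k) - 1)‼ : ℕ) := by
  have : Fintype (Matching (Fin n × Bool)) := Fintype.ofFinite _
  let S : Fin n → Finset (Matching (Fin n × Bool)) := fun b =>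
    Finset.univ.filter fun M => M.partner (b, false) = (b, true)
  have h := Finset.inclusion_exclusion_card_inf_compl (Finset.univ : Finset (Fin n)) S
  have h1 : ((Finset.univ : Finset (Fin n)).inf fun i => (S i)ᶜ) =
      Finset.univ.filter NoFixedBlock := by
    ext M
    simp [Finset.mem_inf, S, NoFixedBlock]
  have h2 : ∀ t : Finset (Fin n), (t.inf S).card = (2 * (n - t.card) - 1)‼ := by
    intro t
    rw [← card_forall_mem_fixed, Nat.card_eq_fintype_card, Fintype.card_subtype]
    congr 1
    ext M
    simp [Finset.mem_inf, S]
  rw [h1] at h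
  simp only [h2] at h
  rw [Nat.card_eq_fintype_card, Fintype.card_subtype, h,
    Finset.sum_powerset_apply_card (fun k => (-1 : ℤ) ^ k * ((2 * (n - k) - 1)‼ : ℕ))]
  simp only [Finset.card_univ, Fintype.card_fin, nsmul_eq_mul]
  refine Finset.sum_congr rfl fun k _ => ?_
  ring

theorem NoStableStart.noFixedBlock {M : Matching (Fin n × Bool)} (hn : 2 ≤ n)
    (h : M.NoStableStart n) : M.NoFixedBlock := by
  rintro ⟨b, hb⟩ hM
  have hst := (isStable_singleton_iff M hb).2 hM
  rcases Nat.eq_zero_or_pos b with rfl | hb0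
  · exact h 1 n le_rfl (by omega) (by omega) le_rfl (isStable_initial_iff.1 hst)
  · exact h b (b + 1) hb0 hb (by omega) hb hst

/-- A stable interval of length `1` is a fixed block, and one of length `n - 1` avoiding block `0`
has the fixed block `0` as complement. -/
theorem NoFixedBlock.exists_isStable {M : Matching (Fin n × Bool)} (h : M.NoFixedBlock)
    (hM : ¬ M.NoStableStart n) :
    ∃ i < n, ∃ l ∈ Finset.Icc 2 (n - 2), i + l ≤ n ∧ M.IsStable i (i + l) := by
  simp only [NoStableStart, not_forall, not_not] at hM
  obtain ⟨i, j, h1, hin, hij, hjn, hst⟩ := hM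
  have hne1 : j ≠ i + 1 := by
    rintro rfl
    exact h _ ((isStable_singleton_iff M hin).1 hst)
  have hne2 : ¬ (i = 1 ∧ j = n) := by
    rintro ⟨rfl, rfl⟩
    exact h _ ((isStable_singleton_iff M (by omega)).1 (isStable_initial_iff.2 hst))
  refine ⟨i, hin, j - i, Finset.mem_Icc.2 (by omega), by omega, ?_⟩
  rwa [Nat.add_sub_cancel' hij.le]

open Classical in
theorem card_noFixedBlock_le (n : ℕ) :
    Nat.card {M : Matching (Fin n × Bool) // M.NoFixedBlock} ≤ numFull n +
      n * ∑ l ∈ Finset.Icc 2 (n - 2), (2 * l - 1)‼ * (2 * (n - l) - 1)‼ := by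
  have : Fintype (Matching (Fin n × Bool)) := Fintype.ofFinite _
  let B : ℕ → ℕ → Finset (Matching (Fin n × Bool)) := fun i l =>
    Finset.univ.filter fun M => i + l ≤ n ∧ M.IsStable i (i + l)
  have hB : ∀ i l, (B i l).card ≤ (2 * l - 1)‼ * (2 * (n - l) - 1)‼ := by
    intro i l
    by_cases hil : i + l ≤ n
    · obtain ⟨m, rfl⟩ : ∃ m, n = m + l := ⟨n - l, by omega⟩
      rw [Nat.add_sub_cancel, ← card_isStable (p := i) (by omega), Nat.card_eq_fintype_card,
        Fintype.card_subtype]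
      exact Finset.card_le_card fun M hM => by simp_all [B]
    · simp [B, hil]
  rw [numFull_eq_card le_rfl, Nat.card_eq_fintype_card, Fintype.card_subtype,
    Nat.card_eq_fintype_card, Fintype.card_subtype]
  calc _ ≤ (Finset.univ.filter (NoStableStart n) ∪ (Finset.range n).biUnion fun i =>
        (Finset.Icc 2 (n - 2)).biUnion fun l => B i l).card := by
        refine Finset.card_le_card fun M hM => ?_
        by_cases h : M.NoStableStart n
        · exact Finset.mem_union_left _ (by simpa using h)
        · obtain ⟨i, hi, l, hl, hil⟩ := NoFixedBlock.exists_isStable (by simpa using hM) h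
          refine Finset.mem_union_right _ (Finset.mem_biUnion.2 ⟨i, Finset.mem_range.2 hi,
            Finset.mem_biUnion.2 ⟨l, hl, ?_⟩⟩)
          simpa [B] using hil
    _ ≤ _ := by
        refine (Finset.card_union_le _ _).trans (Nat.add_le_add_left ?_ _)
        refine Finset.card_biUnion_le.trans ((Finset.sum_le_sum fun i _ =>
          Finset.card_biUnion_le.trans (Finset.sum_le_sum fun l _ => hB i l)).trans ?_)
        simp

theorem numFull_le_card_noFixedBlock (hn : 2 ≤ n) :
    numFull n ≤ Nat.card {M : Matching (Fin n × Bool) // M.NoFixedBlock} := by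
  rw [numFull_eq_card le_rfl]
  exact Nat.card_le_card_of_injective _
    (Subtype.impEmbedding _ _ fun M hM => NoStableStart.noFixedBlock hn hM).injective

end Matching

/-! ### Estimates of odd double factorials. -/

theorem doubleFactorial_odd_succ (m : ℕ) : (2 * (m + 1) - 1)‼ = (2 * m + 1) * (2 * m - 1)‼ := by
  rw [show 2 * (m + 1) - 1 = 2 * m + 1 by omega, Nat.doubleFactorial_add_one]

/-- Log-convexity: moving one unit from the smaller index to the larger replaces a factor by a
larger one. -/
theorem doubleFactorial_odd_mul_le {c a b : ℕ} (hca : c ≤ a) (hab : a ≤ b) :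
    (2 * a - 1)‼ * (2 * b - 1)‼ ≤ (2 * c - 1)‼ * (2 * (a + b - c) - 1)‼ := by
  induction a, hca using Nat.le_induction generalizing b with
  | base => rw [Nat.add_sub_cancel_left]
  | succ a hca ih =>
    refine le_trans ?_ ((ih (b := b + 1) (by omega)).trans_eq (by
      rw [show a + (b + 1) = a + 1 + b by ring]))
    rw [doubleFactorial_odd_succ, doubleFactorial_odd_succ, mul_assoc, mul_left_comm (_‼)]
    exact Nat.mul_le_mul_right _ (by omega)

theorem doubleFactorial_odd_mul_le' {c a b : ℕ} (hca : c ≤ a) (hcb : c ≤ b) :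
    (2 * a - 1)‼ * (2 * b - 1)‼ ≤ (2 * c - 1)‼ * (2 * (a + b - c) - 1)‼ := by
  rcases le_total a b with h | h
  · exact doubleFactorial_odd_mul_le hca h
  · rw [mul_comm, add_comm a b]
    exact doubleFactorial_odd_mul_le hcb h

theorem sum_doubleFactorial_odd_mul_le (m : ℕ) :
    ∑ l ∈ Finset.Icc 2 (m + 1), (2 * l - 1)‼ * (2 * (m + 3 - l) - 1)‼ ≤
      6 * (2 * (m + 1) - 1)‼ + 15 * m * (2 * m - 1)‼ := by
  -- The end terms `l = 2, m + 1` dominate, with `3‼ = 3`; all others are compared with index `3`,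
  -- where `5‼ = 15`.
  have key : ∀ l ∈ Finset.Icc 2 (m + 1), (2 * l - 1)‼ * (2 * (m + 3 - l) - 1)‼ ≤
      (if l = 2 then 3 * (2 * (m + 1) - 1)‼ else 0) +
      (if l = m + 1 then 3 * (2 * (m + 1) - 1)‼ else 0) + 15 * (2 * m - 1)‼ := by
    intro l hl
    rw [Finset.mem_Icc] at hl
    have h3 : (2 * 2 - 1)‼ = 3 := rfl
    have h15 : (2 * 3 - 1)‼ = 15 := rfl
    by_cases h2 : l = 2 ∨ l = m + 1
    · have := doubleFactorial_odd_mul_le' (c := 2) (a := l) (b := m + 3 - l) (by omega) (by omega)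
      rw [h3, show l + (m + 3 - l) - 2 = m + 1 by omega] at this
      rcases h2 with h2 | h2
      · rw [if_pos h2]; omega
      · rw [if_pos h2]; omega
    · have := doubleFactorial_odd_mul_le' (c := 3) (a := l) (b := m + 3 - l) (by omega) (by omega)
      rw [h15, show l + (m + 3 - l) - 3 = m by omega] at this
      omega
  refine (Finset.sum_le_sum key).trans ?_
  rw [Finset.sum_add_distrib, Finset.sum_add_distrib, Finset.sum_ite_eq', Finset.sum_ite_eq',
    Finset.sum_const, Nat.card_Icc, smul_eq_mul, show m + 1 + 1 - 2 = m by omega]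
  split_ifs <;> nlinarith [Nat.zero_le ((2 * (m + 1) - 1)‼)]

/-! ### The limit `e^{-1/2}`. -/

/-- The normalized terms of the inclusion-exclusion formula, up to sign. -/
noncomputable def choosePairsRatio (n k : ℕ) : ℝ :=
  n.choose k * ((2 * (n - k) - 1)‼ : ℕ) / ((2 * n - 1)‼ : ℕ)

theorem choosePairsRatio_succ {n k : ℕ} (h : k < n) :
    choosePairsRatio n (k + 1) =
      choosePairsRatio n k * ((n - k : ℝ) / ((k + 1) * (2 * (n - k) - 1))) := by
  obtain ⟨d, rfl⟩ : ∃ d, n = k + (d + 1) := ⟨n - k - 1, by omega⟩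
  have hN : (((2 * (k + (d + 1)) - 1)‼ : ℕ) : ℝ) ≠ 0 :=
    Nat.cast_ne_zero.2 (Nat.doubleFactorial_pos _).ne'
  have hc : ((k + (d + 1)).choose (k + 1) : ℝ) * (k + 1) = (k + (d + 1)).choose k * (d + 1) := by
    have := Nat.choose_succ_right_eq (k + (d + 1)) k
    rw [Nat.add_sub_cancel_left] at this
    exact_mod_cast this
  rw [choosePairsRatio, choosePairsRatio, show k + (d + 1) - (k + 1) = d by omega,
    Nat.add_sub_cancel_left, doubleFactorial_odd_succ d]
  have h1 : (k + 1 : ℝ) ≠ 0 := by positivity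
  have h2 : (2 * (d + 1 : ℝ) - 1) ≠ 0 := by
    have : (0 : ℝ) ≤ d := by positivity
    linarith
  push_cast
  rw [show (k + (d + 1) - k : ℝ) = d + 1 by ring]
  field_simp
  linear_combination (2 * (d : ℝ) + 1) * hc

theorem choosePairsRatio_zero (n : ℕ) : choosePairsRatio n 0 = 1 := by
  have hN : (((2 * n - 1)‼ : ℕ) : ℝ) ≠ 0 := Nat.cast_ne_zero.2 (Nat.doubleFactorial_pos _).ne'
  simp [choosePairsRatio, hN]

theorem choosePairsRatio_nonneg (n k : ℕ) : 0 ≤ choosePairsRatio n k := by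
  unfold choosePairsRatio
  positivity

/-- For `k < n`, `(n - k) / (2(n - k) - 1) ≤ 1`. The bound is uniform in `n` and summable, as
dominated convergence requires. -/
theorem choosePairsRatio_le (n k : ℕ) : choosePairsRatio n k ≤ 1 / (k ! : ℝ) := by
  induction k with
  | zero => simp [choosePairsRatio_zero]
  | succ k ih =>
    rcases Nat.lt_or_ge k n with h | h
    · rw [choosePairsRatio_succ h, Nat.factorial_succ, mul_comm (k + 1), Nat.cast_mul,
        ← one_div_mul_one_div]
      have h1 : (k : ℝ) + 1 ≤ n := by exact_mod_cast h
      have hd : 0 < 2 * ((n : ℝ) - k) - 1 := by linarith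
      refine mul_le_mul ih ?_ (div_nonneg (by linarith) (mul_pos (by positivity) hd).le)
        (by positivity)
      push_cast
      rw [div_le_div_iff₀ (mul_pos (by positivity) hd) (by positivity)]
      nlinarith [Nat.cast_nonneg (α := ℝ) k]
    · rw [choosePairsRatio, Nat.choose_eq_zero_of_lt (by omega)]
      simp

theorem tendsto_choosePairsRatio (k : ℕ) :
    Tendsto (fun n => choosePairsRatio n k) atTop (𝓝 ((1 / 2) ^ k / (k ! : ℝ))) := by
  induction k with
  | zero => simp [choosePairsRatio_zero]
  | succ k ih =>
    have h1 : Tendsto (fun n : ℕ => (1 / (k + 1 : ℝ)) * (1 / (2 - 1 / ((n : ℝ) - k)))) atTop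
        (𝓝 ((1 / (k + 1 : ℝ)) * (1 / (2 - 0)))) := by
      have hn : Tendsto (fun n : ℕ => (n : ℝ) - k) atTop atTop :=
        tendsto_atTop_add_const_right _ _ tendsto_natCast_atTop_atTop
      refine Tendsto.const_mul _ (Tendsto.div tendsto_const_nhds
        (tendsto_const_nhds.sub ?_) (by norm_num))
      exact tendsto_const_nhds.div_atTop hn
    have h2 := ih.mul h1
    have hlim : (1 / 2 : ℝ) ^ k / (k ! : ℝ) * ((1 / (k + 1 : ℝ)) * (1 / (2 - 0))) =
        (1 / 2) ^ (k + 1) / ((k + 1)! : ℝ) := by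
      rw [Nat.factorial_succ]
      push_cast
      field_simp
      ring
    rw [hlim] at h2
    refine h2.congr' ?_
    filter_upwards [eventually_gt_atTop k] with n hn
    rw [choosePairsRatio_succ hn]
    have h1 : (k : ℝ) + 1 ≤ n := by exact_mod_cast hn
    have hd : 2 * ((n : ℝ) - k) - 1 ≠ 0 := by linarith
    have hd' : (n : ℝ) - k ≠ 0 := by linarith
    have hd'' : 2 - 1 / ((n : ℝ) - k) ≠ 0 := by
      rw [show 2 - 1 / ((n : ℝ) - k) = (2 * ((n : ℝ) - k) - 1) / ((n : ℝ) - k) by field_simp]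
      exact div_ne_zero hd hd'
    congr 1
    field_simp

theorem tendsto_card_noFixedBlock :
    Tendsto (fun n : ℕ => (Nat.card {M : Matching (Fin n × Bool) // M.NoFixedBlock} : ℝ) /
      ((2 * n - 1)‼ : ℕ)) atTop (𝓝 (Real.exp (-1 / 2))) := by
  have h := tendsto_tsum_of_dominated_convergence (𝓕 := atTop)
    (f := fun (n : ℕ) (k : ℕ) => (-1 : ℝ) ^ k * choosePairsRatio n k)
    (g := fun k => (-1 : ℝ) ^ k * ((1 / 2) ^ k / (k ! : ℝ)))
    (bound := fun k => 1 / (k ! : ℝ))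
    (by simpa using Real.summable_pow_div_factorial 1)
    (fun k => (tendsto_choosePairsRatio k).const_mul _)
    (Eventually.of_forall fun n k => by
      rw [norm_mul, norm_pow, norm_neg, norm_one, one_pow, one_mul, Real.norm_eq_abs,
        abs_of_nonneg (choosePairsRatio_nonneg n k)]
      exact choosePairsRatio_le n k)
  have hexp : ∑' k : ℕ, (-1 : ℝ) ^ k * ((1 / 2) ^ k / (k ! : ℝ)) = Real.exp (-1 / 2) := by
    rw [Real.exp_eq_exp_ℝ, NormedSpace.exp_eq_tsum_div]
    refine tsum_congr fun k => ?_
    rw [← mul_div_assoc, ← mul_pow]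
    norm_num
  rw [hexp] at h
  refine h.congr fun n => ?_
  rw [tsum_eq_sum (s := Finset.range (n + 1))]
  · have := congrArg (Int.cast (R := ℝ)) (Matching.card_noFixedBlock n)
    push_cast at this
    rw [this, Finset.sum_div]
    refine Finset.sum_congr rfl fun k _ => ?_
    rw [choosePairsRatio]
    ring
  · intro k hk
    rw [choosePairsRatio, Nat.choose_eq_zero_of_lt (by simpa using hk)]
    simp

theorem card_noFixedBlock_div_le (m : ℕ) :
    (Nat.card {M : Matching (Fin (m + 3) × Bool) // M.NoFixedBlock} : ℝ) /
        ((2 * (m + 3) - 1)‼ : ℕ) - 153 * (1 / ((m : ℝ) + 1)) ≤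
      numFull (m + 3) / ((2 * (m + 3) - 1)‼ : ℕ) := by
  have hN : (0 : ℝ) < ((2 * m - 1)‼ : ℕ) := Nat.cast_pos.2 (Nat.doubleFactorial_pos _)
  have h : (Nat.card {M : Matching (Fin (m + 3) × Bool) // M.NoFixedBlock} : ℝ) ≤
      numFull (m + 3) + (m + 3) * (6 * ((2 * m + 1) * ((2 * m - 1)‼ : ℕ)) +
        15 * m * ((2 * m - 1)‼ : ℕ)) := by
    have := (Matching.card_noFixedBlock_le (m + 3)).trans (Nat.add_le_add_left
      (Nat.mul_le_mul_left _ (sum_doubleFactorial_odd_mul_le m)) _)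
    rw [doubleFactorial_odd_succ] at this
    exact_mod_cast this
  have hD : (((2 * (m + 3) - 1)‼ : ℕ) : ℝ) =
      (2 * m + 5) * ((2 * m + 3) * ((2 * m + 1) * ((2 * m - 1)‼ : ℕ))) := by
    rw [doubleFactorial_odd_succ (m + 2), doubleFactorial_odd_succ (m + 1),
      doubleFactorial_odd_succ m]
    push_cast
    ring
  rw [sub_le_iff_le_add', ← sub_le_iff_le_add, ← sub_div, hD, mul_one_div,
    div_le_div_iff₀ (by positivity) (by positivity)]
  have hm : (0 : ℝ) ≤ m := by positivity
  have h' := mul_le_mul_of_nonneg_right (sub_le_iff_le_add'.2 h) (by positivity : (0 : ℝ) ≤ m + 1)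
  refine h'.trans ?_
  -- Both sides are cubic in `m`; the constant `153` is generous and only its finiteness matters.
  have hp : ((m : ℝ) + 3) * (6 * (2 * m + 1) + 15 * m) * (m + 1) ≤
      153 * ((2 * m + 5) * ((2 * m + 3) * (2 * m + 1))) := by
    nlinarith [pow_nonneg hm 2, pow_nonneg hm 3]
  have := mul_le_mul_of_nonneg_right hp hN.le
  linarith

theorem tendsto_numFull :
    Tendsto (fun n : ℕ => (numFull n : ℝ) / (((2 * n - 1)‼ : ℕ) : ℝ)) atTop
      (𝓝 (Real.exp (-1 / 2))) := by
  rw [← tendsto_add_atTop_iff_nat 3]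
  have hD := (tendsto_add_atTop_iff_nat 3).2 tendsto_card_noFixedBlock
  refine tendsto_of_tendsto_of_tendsto_of_le_of_le ?_ hD card_noFixedBlock_div_le fun m => ?_
  · simpa using hD.sub (tendsto_one_div_add_atTop_nhds_zero_nat.const_mul (153 : ℝ))
  · exact div_le_div_of_nonneg_right
      (Nat.cast_le.2 (Matching.numFull_le_card_noFixedBlock (by omega))) (by positivity)

theorem mainTheorem5 :
    (numFull 1 = 1 ∧
      ∀ n : ℕ, 2 ≤ n →
        (numFull n : ℤ) = 2 * ((n : ℤ) - 1) * (numFull (n - 1) : ℤ) +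
          ∑ j ∈ Finset.Icc 2 (n - 2),
            ((j : ℤ) - 1) * (numFull j : ℤ) * (numFull (n - j) : ℤ)) ∧
    (numFull 0 = 1 ∧
      ∀ n : ℕ, 1 ≤ n →
        PowerSeries.coeff (n - 1) (fullGenFun ^ n) = (n : ℤ) * (((2 * n - 3)‼ : ℕ) : ℤ)) ∧
    Tendsto (fun n : ℕ => (numFull n : ℝ) / (((2 * n - 1)‼ : ℕ) : ℝ)) atTop
      (𝓝 (Real.exp (-1 / 2))) := by
  exact ⟨⟨numFull_one, fun n hn => numFull_recurrence hn⟩,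
    ⟨numFull_zero, fun n hn => coeff_fullGenFun_pow hn⟩, tendsto_numFull⟩
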